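/- Let $k$ be a field, let $n\ge 0$, and let $S=k[x_1,\dots,x_n]$ with its standard grading. For a homogeneous ideal $J\subsetneq S$, the Hilbert function $a\mapsto\dim_k (S/J)_a$ agrees for all large $a$ with a polynomial $P_{S/J}\in\mathbb{Q}[z]$, the Hilbert polynomial. Let $\delta=\dim S/J$ be the Krull dimension. If $\delta\ge 1$, the multiplicity $e_0(S/J)$ is $(\delta-1)!$ times the coefficient of $z^{\delta-1}$ in $P_{S/J}$; if $\delta=0$, then $e_0(S/J)=\dim_k S/J$. **Theorem 1.1.** Let $I$ be a nonzero proper ideal of $S$ generated by squarefree monomials, let $d=\dim S/I$, and let $\mu$ be the number of associated primes $P$ of $S/I$ with $\dim S/P=d$. Then, for every integer $s\ge 1$, $$e_0(S/I^s)=\mu\binom{n-d+s-1}{s-1}.$$ -/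

import Mathlib

namespace MonomialPowers

/-- `I` is generated by squarefree monomials `∏_{i ∈ F} x_i` (`F` ranging over a set of subsets of
the variables). -/
def IsSquarefreeMonomialIdeal {k : Type*} [Field k] {n : ℕ}
    (I : Ideal (MvPolynomial (Fin n) k)) : Prop :=
  ∃ A : Set (Finset (Fin n)),
    I = Ideal.span ((fun F : Finset (Fin n) => ∏ i ∈ F, MvPolynomial.X (R := k) i) '' A)

/-- The component of degree `a` of `S ⧸ J`, for a homogeneous ideal `J` of the standard graded
polynomial ring `S`: the image of the space of forms of degree `a`. -/
noncomputable def gradedPiece {k : Type*} [Field k] {n : ℕ}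
    (J : Ideal (MvPolynomial (Fin n) k)) (a : ℕ) :
    Submodule k (MvPolynomial (Fin n) k ⧸ J) :=
  (MvPolynomial.homogeneousSubmodule (Fin n) k a).map (Ideal.Quotient.mkₐ k J).toLinearMap

/-- The Hilbert function `a ↦ dim_k (S ⧸ J)_a`. -/
noncomputable def hilbertFunction {k : Type*} [Field k] {n : ℕ}
    (J : Ideal (MvPolynomial (Fin n) k)) (a : ℕ) : ℕ :=
  Module.finrank k (gradedPiece J a)

/-- `P` agrees with the Hilbert function of `S ⧸ J` in all large degrees. -/
def IsHilbertPolynomial {k : Type*} [Field k] {n : ℕ}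
    (J : Ideal (MvPolynomial (Fin n) k)) (P : Polynomial ℚ) : Prop :=
  ∀ᶠ a : ℕ in Filter.atTop, P.eval (a : ℚ) = (hilbertFunction J a : ℚ)

open Classical in
/-- The Hilbert polynomial of `S ⧸ J`. -/
noncomputable def hilbertPolynomial {k : Type*} [Field k] {n : ℕ}
    (J : Ideal (MvPolynomial (Fin n) k)) : Polynomial ℚ :=
  if h : ∃ P : Polynomial ℚ, IsHilbertPolynomial J P then h.choose else 0

/-- The Hilbert polynomial is unique, so `hilbertPolynomial` picks the right one. -/
theorem IsHilbertPolynomial.eq {k : Type*} [Field k] {n : ℕ}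
    {J : Ideal (MvPolynomial (Fin n) k)} {P : Polynomial ℚ} (hP : IsHilbertPolynomial J P) :
    hilbertPolynomial J = P := by
  have h : ∃ P : Polynomial ℚ, IsHilbertPolynomial J P := ⟨P, hP⟩
  have hc : IsHilbertPolynomial J (hilbertPolynomial J) := by
    rw [hilbertPolynomial, dif_pos h]
    exact h.choose_spec
  obtain ⟨N, hN⟩ := Filter.eventually_atTop.mp (hc.and hP)
  refine Polynomial.eq_of_infinite_eval_eq _ _ ?_
  refine Set.Infinite.mono ?_ ((Set.Ici_infinite N).image (Nat.cast_injective (R := ℚ)).injOn)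
  rintro _ ⟨a, ha, rfl⟩
  exact (hN a ha).1.trans (hN a ha).2.symm

open Classical in
/-- The multiplicity `e₀(S ⧸ J)`. If `dim S ⧸ J = D + 1 ≥ 1`, the Hilbert polynomial has the form
`∑_{i=0}^{D} (-1)^i e_i C(z + D - i, D - i)`, in which only the summand `i = 0` contributes to the
coefficient of `z ^ D`; so `e₀` is `D!` times that coefficient. If `dim S ⧸ J = 0`, the Hilbert
series is a polynomial `Q`, and `e₀ = Q(1)` is the total dimension `dim_k S ⧸ J`.
(The zero ring has multiplicity `0`, as its Hilbert polynomial is `0`.) -/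
noncomputable def e₀ {k : Type*} [Field k] {n : ℕ}
    (J : Ideal (MvPolynomial (Fin n) k)) : ℚ :=
  if ringKrullDim (MvPolynomial (Fin n) k ⧸ J) = 0 then
    (Module.finrank k (MvPolynomial (Fin n) k ⧸ J) : ℚ)
  else
    let D : ℕ := ((ringKrullDim (MvPolynomial (Fin n) k ⧸ J)).unbotD 0).toNat - 1
    (D.factorial : ℚ) * (hilbertPolynomial J).coeff D

/-- The number of associated primes `P` of `S ⧸ I` with `dim S ⧸ P = d`. -/
noncomputable def numAssPrimes {k : Type*} [Field k] {n : ℕ}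
    (I : Ideal (MvPolynomial (Fin n) k)) (d : ℕ) : ℕ :=
  {P ∈ associatedPrimes (MvPolynomial (Fin n) k) (MvPolynomial (Fin n) k ⧸ I) |
    ringKrullDim (MvPolynomial (Fin n) k ⧸ P) = d}.ncard

end MonomialPowers

/-!
Let `I` be generated by the squarefree monomials `x ^ F`, `F ∈ A`, and call a set `U` of variables a
face if it contains no member of `A`. Both sides of the formula count exponent vectors.

A product of `s` generators has exponents at most `s`, so whether `x ^ e` lies in `I ^ s` depends
only on the truncation `t = min (e, s)` (`isPowerExponent_truncate`). Sorting the monomials outside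
`I ^ s` by their truncation, those of degree `a` with truncation `t` arise by raising `t` on its top
set `U = {i | t i = s}`, which is a face; their number is for `a ≫ 0` a polynomial in `a` of degree
`#U - 1` with leading coefficient `1 / (#U - 1)!`, or zero if `U` is empty. Hence the Hilbert
polynomial of `S ⧸ I ^ s` is a finite sum of such polynomials (`eval_standardPolynomial`), and its
multiplicity is the number of truncated exponents outside `I ^ s` whose top set has the largest
possible size `d` (`factorial_mul_coeff_standardPolynomial`). If `d = 0`, these are all the
exponents outside `I ^ s`, so they count the dimension of `S ⧸ I ^ s`.

For a face `U` of size `d`, inverting the variables of `U` turns `I` into the ideal generated by the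
other `n - d` variables. So a truncated exponent with top set `U` is outside `I ^ s` exactly when
its entries outside `U` add up to less than `s` (`isPowerExponent_iff_of_maximal`), which leaves
`(n - d + s - 1).choose (s - 1)` of them (`card_truncatedStandard_topSet_eq`).

Finally, the primes above `I` are those containing the prime generated by the variables outside some
face `U`, whose quotient has dimension `#U`. So `d` is the dimension of `S ⧸ I` and of `S ⧸ I ^ s`
(`ringKrullDim_quotient_pow`), and the associated primes of dimension `d` correspond to the faces of
size `d` (`numAssPrimes_eq`).
-/

namespace MonomialPowers

set_option linter.unusedSectionVars false

open Finset

/-! ### Exponents of monomials outside a power -/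

section Combinatorics

variable {σ : Type*} [Fintype σ] [DecidableEq σ] {A : Set (Finset σ)} {s : ℕ}

/-- `U` contains no member of `A`: `U` is a face of the Stanley–Reisner complex of the ideal
generated by the squarefree monomials `x ^ F`, `F ∈ A`. -/
def IsFace (A : Set (Finset σ)) (U : Finset σ) : Prop :=
  ∀ G ∈ A, ¬ G ⊆ U

/-- `e` is the exponent of a monomial divisible by a product of `s` squarefree monomials `x ^ F`,
`F ∈ A`; equivalently, of a monomial in the `s`-th power of the ideal they generate. -/
def IsPowerExponent (A : Set (Finset σ)) (s : ℕ) (e : σ → ℕ) : Prop :=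
  ∃ c : Fin s → Finset σ, (∀ j, c j ∈ A) ∧ ∀ i, #{j | i ∈ c j} ≤ e i

/-- Truncation of an exponent vector at `s`. -/
def truncate (s : ℕ) (e : σ → ℕ) : σ → ℕ := fun i => min (e i) s

/-- The coordinates at which an exponent vector is at least `s`. -/
def topSet (s : ℕ) (e : σ → ℕ) : Finset σ := {i | s ≤ e i}

lemma mem_topSet {e : σ → ℕ} {i : σ} : i ∈ topSet s e ↔ s ≤ e i := by simp [topSet]

open Classical in
/-- The exponent vectors of the monomials outside the `s`-th power whose entries are at most `s`. -/
noncomputable def truncatedStandard (A : Set (Finset σ)) (s : ℕ) : Finset (σ → ℕ) :=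
  {t ∈ Fintype.piFinset (fun _ => range (s + 1)) | ¬ IsPowerExponent A s t}

lemma mem_truncatedStandard {t : σ → ℕ} :
    t ∈ truncatedStandard A s ↔ (∀ i, t i ≤ s) ∧ ¬ IsPowerExponent A s t := by
  simp [truncatedStandard]

/-- A product of `s` squarefree monomials has exponents at most `s`, so membership in the `s`-th
power is insensitive to truncation at `s`. -/
lemma isPowerExponent_truncate {e : σ → ℕ} :
    IsPowerExponent A s (truncate s e) ↔ IsPowerExponent A s e := by
  refine exists_congr fun c => and_congr_right fun _ => forall_congr' fun i => ?_
  have : #{j | i ∈ c j} ≤ s := (card_le_univ _).trans_eq (Fintype.card_fin s)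
  simp [truncate, this]

lemma isFace_topSet {e : σ → ℕ} (he : ¬ IsPowerExponent A s e) : IsFace A (topSet s e) := by
  intro G hG hsub
  refine he ⟨fun _ => G, fun _ => hG, fun i => ?_⟩
  by_cases hi : i ∈ G
  · simpa [hi] using mem_topSet.1 (hsub hi)
  · simp [hi]

/-- A sequence of `s` indices in `C` can be chosen using each `i` at most `t i` times as soon as
these bounds add up to at least `s`. -/
lemma exists_sequence_card_fiber_le {C : Finset σ} {t : σ → ℕ} (h : s ≤ ∑ i ∈ C, t i) :
    ∃ f : Fin s → σ, (∀ j, f j ∈ C) ∧ ∀ i, #{j | f j = i} ≤ t i := by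
  have hcard : Fintype.card (Fin s) ≤ Fintype.card (C.sigma fun i => range (t i)) := by
    simpa using h
  obtain ⟨g⟩ := Function.Embedding.nonempty_of_card_le hcard
  refine ⟨fun j => (g j).1.1, fun j => (mem_sigma.1 (g j).2).1, fun i => ?_⟩
  calc #{j | (g j).1.1 = i} ≤ #(range (t i)) := by
        refine card_le_card_of_injOn (fun j => (g j).1.2) ?_ ?_
        · intro j hj
          have hj' : (g j).1.1 = i := by simpa using hj
          have := (mem_sigma.1 (g j).2).2
          rw [hj'] at this
          exact this
        · intro j hj j' hj' hjj
          have h1 : (g j).1.1 = i := by simpa using hj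
          have h2 : (g j').1.1 = i := by simpa using hj'
          exact g.injective (Subtype.ext (Sigma.ext (h1.trans h2.symm) (heq_of_eq hjj)))
    _ = t i := card_range _

/-- At a maximal face `U`, the localization of the ideal is generated by the variables outside `U`;
for exponents that are large on `U`, membership in the `s`-th power is therefore decided by the
degree in those variables. -/
lemma isPowerExponent_iff_of_maximal {U : Finset σ} (hU : IsFace A U)
    (hmax : ∀ i ∉ U, ¬ IsFace A (insert i U)) {e : σ → ℕ} (he : ∀ i ∈ U, s ≤ e i) :
    IsPowerExponent A s e ↔ s ≤ ∑ i ∈ Uᶜ, e i := by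
  constructor
  · rintro ⟨c, hc, hce⟩
    calc s = ∑ _j : Fin s, 1 := by simp
      _ ≤ ∑ j, #{i ∈ Uᶜ | i ∈ c j} := by
          refine sum_le_sum fun j _ => ?_
          obtain ⟨i, hi, hiU⟩ := not_subset.1 (hU _ (hc j))
          exact card_pos.2 ⟨i, by simp [hi, hiU]⟩
      _ = ∑ i ∈ Uᶜ, #{j | i ∈ c j} := by
          simp only [card_filter]
          exact sum_comm
      _ ≤ _ := sum_le_sum fun i _ => hce i
  · intro h
    obtain ⟨f, hf, hfe⟩ := exists_sequence_card_fiber_le h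
    have hG : ∀ j, ∃ G ∈ A, G ⊆ insert (f j) U := fun j => by
      simpa [IsFace] using hmax (f j) (by simpa using hf j)
    choose G hGA hGs using hG
    refine ⟨G, hGA, fun i => ?_⟩
    by_cases hi : i ∈ U
    · exact ((card_le_univ _).trans_eq (Fintype.card_fin s)).trans (he i hi)
    · refine (card_le_card fun j hj => ?_).trans (hfe i)
      have := hGs j (by simpa using hj)
      simp only [mem_insert, hi, or_false] at this
      simp [this]

lemma card_piAntidiag_nat (C : Finset σ) (a : ℕ) :
    #(piAntidiag C a) = (#C + a - 1).choose a := by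
  rw [← card_finsuppAntidiag_nat_eq_choose]
  refine card_equiv Finsupp.equivFunOnFinite.symm fun f => ?_
  simp [mem_finsuppAntidiag, subset_iff]

/-- The number of vectors in `ℕ ^ C` with sum less than `s`. -/
lemma sum_range_card_piAntidiag (C : Finset σ) (hs : 1 ≤ s) :
    ∑ j ∈ range s, #(piAntidiag C j) = (#C + s - 1).choose (s - 1) := by
  obtain ⟨s, rfl⟩ := Nat.exists_eq_add_of_le' hs
  induction s with
  | zero => simp
  | succ m ih =>
    rw [sum_range_succ, ih (by omega), card_piAntidiag_nat]
    have h1 : #C + (m + 1 + 1) - 1 = (#C + m) + 1 := by omega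
    have h2 : #C + (m + 1) - 1 = #C + m := by omega
    have h3 : m + 1 + 1 - 1 = m + 1 := by omega
    rw [h1, h2, h3, Nat.choose_succ_succ, Nat.add_sub_cancel]

/-- The truncated exponents outside the `s`-th power that equal `s` exactly on a maximal face `U`
correspond to the vectors on the complement of `U` with sum less than `s`. -/
lemma card_truncatedStandard_topSet_eq (hs : 1 ≤ s) {U : Finset σ} (hU : IsFace A U)
    (hmax : ∀ i ∉ U, ¬ IsFace A (insert i U)) :
    #{t ∈ truncatedStandard A s | topSet s t = U} =
      (Fintype.card σ - #U + s - 1).choose (s - 1) := by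
  rw [← card_compl, ← sum_range_card_piAntidiag _ hs, ← card_sigma]
  have hmem : ∀ t : σ → ℕ, t ∈ {t ∈ truncatedStandard A s | topSet s t = U} ↔
      (∀ i ∈ U, t i = s) ∧ ∑ i ∈ Uᶜ, t i < s := by
    intro t
    rw [mem_filter, mem_truncatedStandard]
    constructor
    · rintro ⟨⟨hle, hne⟩, rfl⟩
      have hge : ∀ i ∈ topSet s t, s ≤ t i := fun i hi => mem_topSet.1 hi
      rw [isPowerExponent_iff_of_maximal hU hmax hge] at hne
      exact ⟨fun i hi => (hle i).antisymm (hge i hi), not_le.1 hne⟩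
    · rintro ⟨heq, hlt⟩
      have hout : ∀ i ∉ U, t i < s := fun i hi =>
        (single_le_sum (f := t) (fun _ _ => Nat.zero_le _) (mem_compl.2 hi)).trans_lt hlt
      refine ⟨⟨fun i => ?_, ?_⟩, ?_⟩
      · by_cases hi : i ∈ U
        · exact (heq i hi).le
        · exact (hout i hi).le
      · rw [isPowerExponent_iff_of_maximal hU hmax fun i hi => (heq i hi).ge]
        exact not_le.2 hlt
      · ext i
        rw [mem_topSet]
        by_cases hi : i ∈ U
        · simp [hi, heq i hi]
        · simpa [hi] using hout i hi
  refine card_bij' (fun t _ => ⟨∑ i ∈ Uᶜ, t i, fun i => if i ∈ U then 0 else t i⟩)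
    (fun g _ => fun i => if i ∈ U then s else g.2 i) ?_ ?_ ?_ ?_
  · intro t ht
    rw [hmem] at ht
    simp only [mem_sigma, mem_range, mem_piAntidiag, mem_compl]
    refine ⟨ht.2, sum_congr rfl fun i hi => if_neg (mem_compl.1 hi), fun i => ?_⟩
    by_cases hi : i ∈ U <;> simp [hi]
  · rintro ⟨j, g⟩ hg
    simp only [mem_sigma, mem_range, mem_piAntidiag, mem_compl] at hg
    rw [hmem]
    refine ⟨fun i hi => if_pos hi, ?_⟩
    rw [sum_congr rfl fun i hi => if_neg (mem_compl.1 hi), hg.2.1]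
    exact hg.1
  · intro t ht
    rw [hmem] at ht
    funext i
    by_cases hi : i ∈ U
    · simp [hi, ht.1 i hi]
    · simp [hi]
  · rintro ⟨j, g⟩ hg
    simp only [mem_sigma, mem_range, mem_piAntidiag, mem_compl] at hg
    refine Sigma.ext ?_ (heq_of_eq ?_)
    · exact (sum_congr rfl fun i hi => if_neg (mem_compl.1 hi)).trans hg.2.1
    · funext i
      by_cases hi : i ∈ U
      · have : g i = 0 := by_contra fun h => hg.2.2 i h hi
        simp [hi, this]
      · simp [hi]

/-- The exponent vectors of degree `a` with a given truncation `t` are obtained by raising `t`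
arbitrarily on its top set. -/
lemma card_filter_truncate_eq {a : ℕ} {t : σ → ℕ} (ht : ∀ i, t i ≤ s) (hta : ∑ i, t i ≤ a) :
    #{e ∈ piAntidiag univ a | truncate s e = t} = #(piAntidiag (topSet s t) (a - ∑ i, t i)) := by
  refine card_bij' (fun e _ => e - t) (fun g _ => g + t) ?_ ?_ ?_ ?_
  · intro e he
    simp only [mem_filter, mem_piAntidiag, mem_univ, implies_true, and_true] at he
    obtain ⟨hea, rfl⟩ := he
    have hle : ∀ i, truncate s e i ≤ e i := fun i => min_le_left _ _
    have hzero : ∀ i ∉ topSet s (truncate s e), (e - truncate s e) i = 0 := by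
      intro i hi
      simp only [mem_topSet, truncate, Pi.sub_apply] at hi ⊢
      omega
    simp only [mem_piAntidiag]
    refine ⟨?_, fun i hi => by_contra fun h => hi (hzero i h)⟩
    rw [sum_subset (subset_univ _) fun i _ hi => hzero i hi]
    simp only [Pi.sub_apply]
    rw [sum_tsub_distrib _ fun i _ => hle i, hea]
  · intro g hg
    simp only [mem_piAntidiag] at hg
    simp only [mem_filter, mem_piAntidiag, mem_univ, implies_true, and_true]
    constructor
    · simp only [Pi.add_apply]
      rw [sum_add_distrib, ← sum_subset (subset_univ (topSet s t)) (fun i _ hi =>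
        by_contra fun h => hi (hg.2 i h)), hg.1]
      omega
    · funext i
      have h1 := ht i
      by_cases h0 : g i = 0
      · simp [truncate, h0, h1]
      · have h2 := mem_topSet.1 (hg.2 i h0)
        simp only [truncate, Pi.add_apply]
        omega
  · intro e he
    simp only [mem_filter] at he
    obtain ⟨-, rfl⟩ := he
    funext i
    simp only [Pi.add_apply, Pi.sub_apply, truncate]
    omega
  · intro g _
    funext i
    simp

/-- The number of exponent vectors with a given truncation, as a polynomial in the degree. It
vanishes when no coordinate may be raised, and has degree one less than the size of the top set
otherwise. -/
noncomputable def fiberPolynomial (s : ℕ) (t : σ → ℕ) : Polynomial ℚ :=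
  if topSet s t = ∅ then 0 else Polynomial.preHilbertPoly ℚ (#(topSet s t) - 1) (∑ i, t i)

lemma eval_fiberPolynomial {a : ℕ} {t : σ → ℕ} (ht : ∀ i, t i ≤ s) (hta : ∑ i, t i < a) :
    (fiberPolynomial s t).eval (a : ℚ) = #{e ∈ piAntidiag univ a | truncate s e = t} := by
  rw [card_filter_truncate_eq ht hta.le, fiberPolynomial]
  split_ifs with h
  · rw [h, piAntidiag_empty_of_ne_zero (by omega)]
    simp
  · rw [Polynomial.preHilbertPoly_eq_choose_sub_add _ _ hta.le, card_piAntidiag_nat]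
    have hpos : 0 < #(topSet s t) := card_pos.2 (nonempty_iff_ne_empty.2 h)
    have h1 : #(topSet s t) + (a - ∑ i, t i) - 1 = (a - ∑ i, t i) + (#(topSet s t) - 1) := by omega
    rw [h1, Nat.choose_symm_add]

/-- The Hilbert polynomial of the quotient by the `s`-th power. -/
noncomputable def standardPolynomial (A : Set (Finset σ)) (s : ℕ) : Polynomial ℚ :=
  ∑ t ∈ truncatedStandard A s, fiberPolynomial s t

open Classical in
lemma eval_standardPolynomial {a : ℕ} (ha : Fintype.card σ * s < a) :
    (standardPolynomial A s).eval (a : ℚ) = #{e ∈ piAntidiag univ a | ¬ IsPowerExponent A s e} := by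
  have hmaps : Set.MapsTo (truncate s)
      (({e ∈ piAntidiag univ a | ¬ IsPowerExponent A s e} : Finset (σ → ℕ)) : Set (σ → ℕ))
      (truncatedStandard A s) := by
    intro e he
    rw [mem_coe, mem_truncatedStandard, isPowerExponent_truncate]
    exact ⟨fun i => min_le_right _ _, (mem_filter.1 (mem_coe.1 he)).2⟩
  rw [card_eq_sum_card_fiberwise hmaps, standardPolynomial, Polynomial.eval_finsetSum,
    Nat.cast_sum]
  refine sum_congr rfl fun t ht => ?_
  rw [mem_truncatedStandard] at ht
  have hta : ∑ i, t i < a := by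
    refine lt_of_le_of_lt ?_ ha
    simpa using sum_le_card_nsmul univ t s fun i _ => ht.1 i
  rw [eval_fiberPolynomial ht.1 hta, filter_filter]
  congr 2
  ext e
  simp only [mem_filter, and_congr_right_iff]
  refine fun _ => ⟨fun h => ⟨?_, h⟩, fun h => h.2⟩
  rw [← isPowerExponent_truncate, h]
  exact ht.2

lemma coeff_fiberPolynomial {d : ℕ} {t : σ → ℕ} (ht : #(topSet s t) ≤ d + 1) :
    (fiberPolynomial s t).coeff d = if #(topSet s t) = d + 1 then (d.factorial : ℚ)⁻¹ else 0 := by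
  rw [fiberPolynomial]
  split_ifs with h0 h1 h1
  · simp [h0] at h1
  · simp
  · rw [h1, Nat.add_sub_cancel, Polynomial.coeff_preHilbertPoly_self]
  · refine Polynomial.coeff_eq_zero_of_natDegree_lt ?_
    rw [Polynomial.natDegree_preHilbertPoly]
    have : 0 < #(topSet s t) := card_pos.2 (nonempty_iff_ne_empty.2 h0)
    omega

lemma not_isFace_insert {d : ℕ} (hle : ∀ U, IsFace A U → #U ≤ d) {U : Finset σ} (hU : #U = d) :
    ∀ i ∉ U, ¬ IsFace A (insert i U) := by
  intro i hi h
  have := hle _ h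
  rw [card_insert_of_notMem hi] at this
  omega

open Classical in
/-- Counting truncated exponents with top set of the largest possible size `d`: each face of size
`d` contributes equally. -/
lemma card_truncatedStandard_card_topSet_eq {d : ℕ} (hs : 1 ≤ s)
    (hle : ∀ U, IsFace A U → #U ≤ d) :
    #{t ∈ truncatedStandard A s | #(topSet s t) = d} =
      #{U : Finset σ | IsFace A U ∧ #U = d} * (Fintype.card σ - d + s - 1).choose (s - 1) := by
  have hmaps : Set.MapsTo (topSet s)
      (({t ∈ truncatedStandard A s | #(topSet s t) = d} : Finset (σ → ℕ)) : Set (σ → ℕ))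
      (({U : Finset σ | IsFace A U ∧ #U = d} : Finset (Finset σ)) : Set (Finset σ)) := by
    intro t ht
    simp only [coe_filter, Set.mem_ofPred_eq, mem_univ, true_and] at ht ⊢
    exact ⟨isFace_topSet (mem_truncatedStandard.1 ht.1).2, ht.2⟩
  rw [card_eq_sum_card_fiberwise hmaps, ← smul_eq_mul]
  refine sum_const_nat (fun U hU => ?_) |>.trans (by rw [smul_eq_mul])
  simp only [mem_filter, mem_univ, true_and] at hU
  obtain ⟨hU, rfl⟩ := hU
  rw [← card_truncatedStandard_topSet_eq hs hU (not_isFace_insert hle rfl), filter_filter]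
  congr 1
  ext t
  simp only [mem_filter]
  exact and_congr_right fun _ => ⟨fun h => h.2, fun h => ⟨by rw [h], h⟩⟩

lemma factorial_mul_coeff_standardPolynomial {d : ℕ} (hle : ∀ U, IsFace A U → #U ≤ d + 1) :
    (d.factorial : ℚ) * (standardPolynomial A s).coeff d =
      #{t ∈ truncatedStandard A s | #(topSet s t) = d + 1} := by
  rw [standardPolynomial, Polynomial.finsetSum_coeff, card_filter, Nat.cast_sum, mul_sum]
  refine sum_congr rfl fun t ht => ?_
  rw [coeff_fiberPolynomial (hle _ (isFace_topSet (mem_truncatedStandard.1 ht).2))]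
  have : (d.factorial : ℚ) ≠ 0 := Nat.cast_ne_zero.2 d.factorial_ne_zero
  split_ifs <;> simp [this]

/-- If the empty set is the only face, every exponent vector outside the `s`-th power is its own
truncation. -/
lemma mem_truncatedStandard_iff_of_forall_card_le_zero (hle : ∀ U, IsFace A U → #U ≤ 0)
    {e : σ → ℕ} : e ∈ truncatedStandard A s ↔ ¬ IsPowerExponent A s e := by
  rw [mem_truncatedStandard, and_iff_right_iff_imp]
  intro he i
  have h0 : topSet s e = ∅ := card_eq_zero.1 (Nat.le_zero.1 (hle _ (isFace_topSet he)))
  exact (not_le.1 fun h => notMem_empty i (h0 ▸ mem_topSet.2 h)).le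

end Combinatorics

/-! ### Monomial bases and the Hilbert function -/

section MonomialIdeal

variable {k : Type*} [Field k] {σ : Type*} [Fintype σ] [DecidableEq σ]

lemma sum_sum_single_apply {s : ℕ} (c : Fin s → Finset σ) (i : σ) :
    (∑ j, ∑ i ∈ c j, Finsupp.single i 1 : σ →₀ ℕ) i = #{j | i ∈ c j} := by
  simp [Finsupp.finsetSum_apply, Finsupp.single_apply]

open scoped Pointwise in
/-- A polynomial lies in the `s`-th power of a squarefree monomial ideal if and only if all its
monomials do. -/
lemma mem_span_pow_iff (A : Set (Finset σ)) (s : ℕ) (f : MvPolynomial σ k) :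
    f ∈ Ideal.span ((fun F : Finset σ => ∏ i ∈ F, MvPolynomial.X (R := k) i) '' A) ^ s ↔
      ∀ e ∈ f.support, IsPowerExponent A s e := by
  have himage : ((fun F : Finset σ => ∏ i ∈ F, MvPolynomial.X (R := k) i) '' A) ^ s =
      (fun e => MvPolynomial.monomial e (1 : k)) ''
        {b | ∃ c : Fin s → Finset σ, (∀ j, c j ∈ A) ∧
          ∑ j, ∑ i ∈ c j, Finsupp.single i 1 = b} := by
    ext g
    rw [Set.mem_pow]
    constructor
    · rintro ⟨h, rfl⟩
      choose c hcA hc using fun j => (h j).2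
      refine ⟨_, ⟨c, hcA, rfl⟩, ?_⟩
      simp only [MvPolynomial.monomial_sum_one, List.prod_ofFn, ← hc]
      rfl
    · rintro ⟨_, ⟨c, hcA, rfl⟩, rfl⟩
      refine ⟨fun j => ⟨_, c j, hcA j, rfl⟩, ?_⟩
      simp only [MvPolynomial.monomial_sum_one, List.prod_ofFn]
      rfl
  rw [Ideal.span, Submodule.span_pow, himage]
  refine MvPolynomial.mem_ideal_span_monomial_image.trans (forall₂_congr fun e _ => ?_)
  simp only [Set.mem_ofPred_eq]
  constructor
  · rintro ⟨_, ⟨c, hc, rfl⟩, hle⟩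
    exact ⟨c, hc, fun i => (sum_sum_single_apply c i).ge.trans (hle i)⟩
  · rintro ⟨c, hc, hle⟩
    exact ⟨_, ⟨c, hc, rfl⟩, fun i => (sum_sum_single_apply c i).trans_le (hle i)⟩

/-- Modulo a monomial ideal, the span of a set of monomials has the monomials outside the ideal as
a basis. -/
lemma finrank_map_span_monomial {J : Ideal (MvPolynomial σ k)} {M : (σ →₀ ℕ) → Prop}
    (hJ : ∀ f, f ∈ J ↔ ∀ e ∈ f.support, M e) (E : Set (σ →₀ ℕ)) :
    Module.finrank k ((Submodule.span k ((fun e => MvPolynomial.monomial e (1 : k)) '' E)).map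
      (Ideal.Quotient.mkₐ k J).toLinearMap) = {e ∈ E | ¬ M e}.ncard := by
  let v : {e ∈ E | ¬ M e} → MvPolynomial σ k ⧸ J :=
    fun e => Ideal.Quotient.mkₐ k J (MvPolynomial.monomial e.1 1)
  have hv : LinearIndependent k v := by
    rw [linearIndependent_iff']
    intro u g hg i hi
    by_contra hne
    have hmem : ∑ e ∈ u, MvPolynomial.monomial e.1 (g e) ∈ J := by
      rw [← Ideal.Quotient.eq_zero_iff_mem, ← Ideal.Quotient.mkₐ_eq_mk k, map_sum, ← hg]
      refine sum_congr rfl fun e _ => ?_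
      rw [← map_smul, MvPolynomial.smul_monomial, smul_eq_mul, mul_one]
    refine i.2.2 ((hJ _).1 hmem i.1 ?_)
    rw [MvPolynomial.mem_support_iff, MvPolynomial.coeff_sum, sum_eq_single i]
    · simpa using hne
    · intro e _ hei
      rw [MvPolynomial.coeff_monomial, if_neg fun h => hei (Subtype.ext h)]
    · exact fun h => (h hi).elim
  have hspan : (Submodule.span k ((fun e => MvPolynomial.monomial e (1 : k)) '' E)).map
      (Ideal.Quotient.mkₐ k J).toLinearMap = Submodule.span k (Set.range v) := by
    rw [Submodule.map_span]
    apply le_antisymm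
    · rw [Submodule.span_le]
      rintro _ ⟨_, ⟨e, he, rfl⟩, rfl⟩
      by_cases hM : M e
      · have : MvPolynomial.monomial e (1 : k) ∈ J := by
          rw [hJ]
          intro e' he'
          rwa [mem_singleton.1 (MvPolynomial.support_monomial_subset he')]
        have h0 : Ideal.Quotient.mkₐ k J (MvPolynomial.monomial e (1 : k)) = 0 :=
          Ideal.Quotient.eq_zero_iff_mem.2 this
        simp [h0]
      · exact Submodule.subset_span ⟨⟨e, he, hM⟩, rfl⟩
    · refine Submodule.span_mono ?_
      rintro _ ⟨e, rfl⟩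
      exact ⟨_, ⟨e.1, e.2.1, rfl⟩, rfl⟩
  rw [hspan, Module.finrank_eq_nat_card_basis (Module.Basis.span hv)]
  rfl

lemma homogeneousSubmodule_eq_span (a : ℕ) :
    MvPolynomial.homogeneousSubmodule σ k a =
      Submodule.span k ((fun e => MvPolynomial.monomial e (1 : k)) '' {e | e.degree = a}) := by
  apply le_antisymm
  · intro f hf
    rw [f.as_sum]
    refine Submodule.sum_mem _ fun e he => ?_
    rw [← mul_one (f.coeff e), ← smul_eq_mul, ← MvPolynomial.smul_monomial]
    refine Submodule.smul_mem _ _ (Submodule.subset_span ⟨e, ?_, rfl⟩)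
    rw [MvPolynomial.mem_support_iff] at he
    have hw : Finsupp.weight 1 e = a := hf he
    exact (DFunLike.congr_fun Finsupp.degree_eq_weight_one e).trans hw
  · rw [Submodule.span_le]
    rintro _ ⟨e, he, rfl⟩
    exact MvPolynomial.isHomogeneous_monomial _ he

open Classical in
lemma hilbertFunction_pow {n : ℕ} (A : Set (Finset (Fin n))) (s a : ℕ) :
    hilbertFunction (Ideal.span ((fun F => ∏ i ∈ F, MvPolynomial.X (R := k) i) '' A) ^ s) a =
      #{e ∈ piAntidiag univ a | ¬ IsPowerExponent A s e} := by
  rw [hilbertFunction, gradedPiece, homogeneousSubmodule_eq_span,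
    finrank_map_span_monomial (M := fun e => IsPowerExponent A s e) (mem_span_pow_iff A s),
    ← Set.ncard_coe_finset]
  refine Set.ncard_congr (fun e _ => ⇑e) ?_ ?_ ?_
  · rintro e ⟨rfl, h2⟩
    simpa [Finsupp.degree_eq_sum] using h2
  · exact fun _ _ _ _ h => DFunLike.coe_injective h
  · intro e he
    refine ⟨Finsupp.equivFunOnFinite.symm e, ?_, rfl⟩
    simpa [Finsupp.degree_eq_sum] using he

lemma finrank_quotient_pow_of_forall_card_le_zero {A : Set (Finset σ)} {s : ℕ}
    (hle : ∀ U, IsFace A U → #U ≤ 0) :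
    Module.finrank k (MvPolynomial σ k ⧸
      Ideal.span ((fun F => ∏ i ∈ F, MvPolynomial.X (R := k) i) '' A) ^ s) =
      #(truncatedStandard A s) := by
  have htop : Submodule.span k ((fun e : σ →₀ ℕ => MvPolynomial.monomial e (1 : k)) '' Set.univ)
      = ⊤ := by
    rw [Set.image_univ, ← MvPolynomial.coe_basisMonomials, Module.Basis.span_eq]
  have h := finrank_map_span_monomial (M := fun e => IsPowerExponent A s e)
    (mem_span_pow_iff (k := k) A s) Set.univ
  rw [htop, Submodule.map_top, LinearMap.range_eq_top.2 (Ideal.Quotient.mkₐ_surjective k _),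
    finrank_top] at h
  rw [h, ← Set.ncard_coe_finset]
  refine Set.ncard_congr (fun e _ => ⇑e) ?_ ?_ ?_
  · rintro e ⟨-, h2⟩
    exact (mem_truncatedStandard_iff_of_forall_card_le_zero hle).2 h2
  · exact fun _ _ _ _ h => DFunLike.coe_injective h
  · intro e he
    exact ⟨Finsupp.equivFunOnFinite.symm e, ⟨trivial,
      (mem_truncatedStandard_iff_of_forall_card_le_zero hle).1 he⟩, rfl⟩

end MonomialIdeal

/-! ### Primes of faces, dimension and associated primes -/

section FacePrimes

variable (k : Type*) [Field k] {σ : Type*} [Fintype σ] [DecidableEq σ]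

/-- The projection of the polynomial ring onto the polynomial ring in the variables of `U`, sending
all other variables to zero. -/
noncomputable def faceProjection (U : Finset σ) : MvPolynomial σ k →ₐ[k] MvPolynomial U k :=
  MvPolynomial.aeval fun i => if h : i ∈ U then MvPolynomial.X ⟨i, h⟩ else 0

/-- The prime ideal generated by the variables outside `U`, encoded as the kernel of the projection
that kills them; `facePrime_le` shows that these variables generate it. -/
noncomputable def facePrime (U : Finset σ) : Ideal (MvPolynomial σ k) :=
  RingHom.ker (faceProjection k U)

instance (U : Finset σ) : (facePrime k U).IsPrime := RingHom.ker_isPrime _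

variable {k}

lemma faceProjection_comp_rename (U : Finset σ) (g : MvPolynomial U k) :
    faceProjection k U (MvPolynomial.rename Subtype.val g) = g := by
  have : (faceProjection k U).comp (MvPolynomial.rename Subtype.val) = AlgHom.id k _ := by
    ext i
    simp [faceProjection]
  exact DFunLike.congr_fun this g

lemma X_mem_facePrime {U : Finset σ} {i : σ} : MvPolynomial.X i ∈ facePrime k U ↔ i ∉ U := by
  rw [facePrime, RingHom.mem_ker]
  by_cases hi : i ∈ U <;> simp [faceProjection, hi]

lemma facePrime_injective : Function.Injective (facePrime k (σ := σ)) := by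
  intro U V h
  ext i
  rw [← not_iff_not, ← X_mem_facePrime (k := k), h, X_mem_facePrime]

/-- The ideal `facePrime k U` is the least ideal containing the variables outside `U`. -/
lemma facePrime_le {U : Finset σ} {P : Ideal (MvPolynomial σ k)}
    (hP : ∀ i ∉ U, MvPolynomial.X i ∈ P) : facePrime k U ≤ P := by
  intro f hf
  have hcomp : (Ideal.Quotient.mkₐ k P) = (Ideal.Quotient.mkₐ k P).comp
      ((MvPolynomial.rename Subtype.val).comp (faceProjection k U)) := by
    ext i
    by_cases hi : i ∈ U
    · simp [faceProjection, hi]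
    · simpa [faceProjection, hi] using Ideal.Quotient.eq_zero_iff_mem.2 (hP i hi)
  rw [← Ideal.Quotient.eq_zero_iff_mem, ← Ideal.Quotient.mkₐ_eq_mk k, hcomp]
  have hf0 : faceProjection k U f = 0 := hf
  simp [hf0]

lemma ringKrullDim_quotient_facePrime (U : Finset σ) :
    ringKrullDim (MvPolynomial σ k ⧸ facePrime k U) = #U := by
  have e := Ideal.quotientKerAlgEquivOfSurjective (f := faceProjection k U)
    fun g => ⟨_, faceProjection_comp_rename U g⟩
  have h := ringKrullDim_eq_of_ringEquiv e.toRingEquiv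
  rw [MvPolynomial.ringKrullDim_of_isNoetherianRing, ringKrullDim_eq_zero_of_field] at h
  rw [facePrime]
  simpa using h

lemma prod_X_mem_prime {P : Ideal (MvPolynomial σ k)} [hP : P.IsPrime] {F : Finset σ} :
    ∏ i ∈ F, MvPolynomial.X (R := k) i ∈ P ↔ ∃ i ∈ F, MvPolynomial.X (R := k) i ∈ P :=
  hP.prod_mem_iff

lemma span_le_facePrime_iff {A : Set (Finset σ)} {U : Finset σ} :
    Ideal.span ((fun F => ∏ i ∈ F, MvPolynomial.X (R := k) i) '' A) ≤ facePrime k U ↔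
      IsFace A U := by
  rw [Ideal.span_le, Set.image_subset_iff]
  refine forall₂_congr fun G _ => ?_
  simp [prod_X_mem_prime, X_mem_facePrime, not_subset]

/-- A prime ideal containing the squarefree monomial ideal contains the prime ideal of a face,
namely of the set of variables outside it. -/
lemma exists_isFace_facePrime_le {A : Set (Finset σ)} {P : Ideal (MvPolynomial σ k)} [P.IsPrime]
    (hP : Ideal.span ((fun F => ∏ i ∈ F, MvPolynomial.X (R := k) i) '' A) ≤ P) :
    ∃ U, IsFace A U ∧ facePrime k U ≤ P := by
  classical
  refine ⟨({i | MvPolynomial.X i ∉ P} : Finset σ), fun G hG hsub => ?_, facePrime_le fun i hi => ?_⟩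
  · obtain ⟨i, hi, hiP⟩ := prod_X_mem_prime.1 (hP (Ideal.subset_span ⟨G, hG, rfl⟩))
    simpa [hiP] using hsub hi
  · simpa using hi

/-- A chain of primes above `J` starts above some `facePrime k U`, so its length is at most `#U`. -/
lemma ringKrullDim_quotient_le {J : Ideal (MvPolynomial σ k)} {d : ℕ}
    (h : ∀ P : Ideal (MvPolynomial σ k), P.IsPrime → J ≤ P → ∃ U, #U ≤ d ∧ facePrime k U ≤ P) :
    ringKrullDim (MvPolynomial σ k ⧸ J) ≤ d := by
  rw [ringKrullDim_quotient]
  refine iSup_le fun p => ?_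
  obtain ⟨U, hU, hUP⟩ := h p.head.1.asIdeal p.head.1.2 p.head.2
  let q : LTSeries (PrimeSpectrum.zeroLocus (facePrime k U : Set (MvPolynomial σ k))) :=
    { length := p.length
      toFun := fun i => ⟨(p i).1, hUP.trans (p.head_le i)⟩
      step := fun i => p.step i }
  have hq : (q.length : WithBot ℕ∞) ≤ _ := Order.LTSeries.length_le_krullDim q
  rw [← ringKrullDim_quotient, ringKrullDim_quotient_facePrime] at hq
  exact hq.trans (by exact_mod_cast hU)

/-- An ideal strictly above the prime `facePrime k U` has a quotient of dimension less than `#U`. -/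
lemma eq_facePrime_of_le {U : Finset σ} {P : Ideal (MvPolynomial σ k)}
    (hUP : facePrime k U ≤ P) (hdim : (#U : WithBot ℕ∞) ≤ ringKrullDim (MvPolynomial σ k ⧸ P)) :
    P = facePrime k U := by
  by_contra hne
  obtain ⟨f, hfP, hfU⟩ := SetLike.exists_of_lt (lt_of_le_of_ne hUP (Ne.symm hne))
  have hlt := ringKrullDim_succ_le_of_surjective (Ideal.Quotient.factor hUP)
    (Ideal.Quotient.factor_surjective hUP) (r := Ideal.Quotient.mk _ f)
    (mem_nonZeroDivisors_of_ne_zero (by rwa [ne_eq, Ideal.Quotient.eq_zero_iff_mem]))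
    (by rwa [Ideal.Quotient.factor_mk, Ideal.Quotient.eq_zero_iff_mem])
  rw [ringKrullDim_quotient_facePrime] at hlt
  have := (add_le_add_left hdim 1).trans hlt
  norm_cast at this
  omega

/-- The prime of a maximal face is the annihilator of the class of the monomial of that face. -/
lemma facePrime_mem_associatedPrimes {A : Set (Finset σ)} {U : Finset σ} (hU : IsFace A U)
    (hmax : ∀ i ∉ U, ¬ IsFace A (insert i U)) :
    facePrime k U ∈ associatedPrimes (MvPolynomial σ k) (MvPolynomial σ k ⧸
      Ideal.span ((fun F => ∏ i ∈ F, MvPolynomial.X (R := k) i) '' A)) := by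
  set I := Ideal.span ((fun F => ∏ i ∈ F, MvPolynomial.X (R := k) i) '' A)
  refine Submodule.isAssociatedPrime_iff.2 ⟨inferInstance,
    Ideal.Quotient.mk I (∏ i ∈ U, MvPolynomial.X i), ?_⟩
  have hcolon : ∀ f, f ∈ Submodule.colon (⊥ : Submodule (MvPolynomial σ k) (MvPolynomial σ k ⧸ I))
      {Ideal.Quotient.mk I (∏ i ∈ U, MvPolynomial.X i)} ↔
        f * ∏ i ∈ U, MvPolynomial.X i ∈ I := by
    intro f
    rw [Submodule.mem_colon_singleton, Submodule.mem_bot, ← Ideal.Quotient.eq_zero_iff_mem]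
    rfl
  apply le_antisymm
  · refine facePrime_le fun i hi => ?_
    rw [hcolon, ← prod_insert hi]
    obtain ⟨G, hG, hGs⟩ : ∃ G ∈ A, G ⊆ insert i U := by simpa [IsFace] using hmax i hi
    exact I.mem_of_dvd (prod_dvd_prod_of_subset _ _ _ hGs) (Ideal.subset_span ⟨G, hG, rfl⟩)
  · intro f hf
    rw [hcolon] at hf
    refine ((inferInstance : (facePrime k U).IsPrime).mem_or_mem
      (span_le_facePrime_iff.2 hU hf)).resolve_right fun h => ?_
    obtain ⟨i, hi, hiP⟩ := prod_X_mem_prime.1 h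
    exact X_mem_facePrime.1 hiP hi

/-- The associated primes of top dimension `d` are the primes of the faces of size `d`. -/
lemma numAssPrimes_eq {n d : ℕ} {A : Set (Finset (Fin n))} (hle : ∀ U, IsFace A U → #U ≤ d) :
    numAssPrimes (Ideal.span ((fun F => ∏ i ∈ F, MvPolynomial.X (R := k) i) '' A)) d =
      {U : Finset (Fin n) | IsFace A U ∧ #U = d}.ncard := by
  rw [numAssPrimes, ← Set.ncard_image_of_injective _ (facePrime_injective (k := k))]
  congr 1
  ext P
  constructor
  · rintro ⟨hP, hdim⟩
    have : P.IsPrime := hP.isPrime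
    have hIP : Ideal.span ((fun F => ∏ i ∈ F, MvPolynomial.X (R := k) i) '' A) ≤ P := by
      simpa [Submodule.annihilator_top, Ideal.annihilator_quotient] using
        IsAssociatedPrime.annihilator_le hP
    obtain ⟨U, hU, hUP⟩ := exists_isFace_facePrime_le hIP
    have heq := eq_facePrime_of_le hUP (by rw [hdim]; exact_mod_cast hle U hU)
    refine ⟨U, ⟨hU, ?_⟩, heq.symm⟩
    rw [heq, ringKrullDim_quotient_facePrime] at hdim
    exact_mod_cast hdim
  · rintro ⟨U, ⟨hU, hUd⟩, rfl⟩
    refine ⟨facePrime_mem_associatedPrimes hU (not_isFace_insert hle hUd), ?_⟩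
    rw [ringKrullDim_quotient_facePrime, hUd]

/-- The powers of a squarefree monomial ideal have the dimension given by the largest face. -/
lemma ringKrullDim_quotient_pow {A : Set (Finset σ)} {U : Finset σ} (hU : IsFace A U)
    (hle : ∀ V, IsFace A V → #V ≤ #U) {s : ℕ} (hs : s ≠ 0) :
    ringKrullDim (MvPolynomial σ k ⧸
      Ideal.span ((fun F => ∏ i ∈ F, MvPolynomial.X (R := k) i) '' A) ^ s) = #U := by
  apply le_antisymm
  · refine ringKrullDim_quotient_le fun P hP hIP => ?_
    obtain ⟨V, hV, hVP⟩ := exists_isFace_facePrime_le (hP.le_of_pow_le hIP)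
    exact ⟨V, hle V hV, hVP⟩
  · rw [← ringKrullDim_quotient_facePrime (k := k) U]
    have hIU := (Ideal.pow_le_self hs).trans (span_le_facePrime_iff (k := k).2 hU)
    exact ringKrullDim_le_of_surjective _ (Ideal.Quotient.factor_surjective hIU)

end FacePrimes

/-! ### The multiplicity of a power -/

section Multiplicity

variable {k : Type*} [Field k]

lemma e₀_span_pow {n d : ℕ} (A : Set (Finset (Fin n)))
    (hd : ringKrullDim (MvPolynomial (Fin n) k ⧸
      Ideal.span ((fun F => ∏ i ∈ F, MvPolynomial.X (R := k) i) '' A)) = d)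
    {s : ℕ} (hs : 1 ≤ s) :
    e₀ (Ideal.span ((fun F => ∏ i ∈ F, MvPolynomial.X (R := k) i) '' A) ^ s) =
      ((numAssPrimes (Ideal.span ((fun F => ∏ i ∈ F, MvPolynomial.X (R := k) i) '' A)) d *
        (n - d + s - 1).choose (s - 1) : ℕ) : ℚ) := by
  classical
  set I := Ideal.span ((fun F => ∏ i ∈ F, MvPolynomial.X (R := k) i) '' A)
  obtain ⟨U₀, hU₀⟩ : ∃ U, IsFace A U := by
    have hne : I ≠ ⊤ := by
      intro h
      have := Ideal.Quotient.subsingleton_iff.2 h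
      rw [ringKrullDim_eq_bot_of_subsingleton] at hd
      exact WithBot.bot_ne_coe hd
    obtain ⟨P, hP, hIP⟩ := Ideal.exists_le_maximal I hne
    have := hP.isPrime
    obtain ⟨U, hU, -⟩ := exists_isFace_facePrime_le hIP
    exact ⟨U, hU⟩
  obtain ⟨U, hU, hmax⟩ := exists_max_image
    ({V | IsFace A V} : Finset (Finset (Fin n))) card ⟨U₀, by simpa using hU₀⟩
  replace hU : IsFace A U := by simpa using hU
  replace hmax : ∀ V, IsFace A V → #V ≤ #U := fun V hV => hmax V (by simpa using hV)
  have hUd : #U = d := by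
    have h := ringKrullDim_quotient_pow (k := k) hU hmax one_ne_zero
    rw [pow_one, hd] at h
    exact_mod_cast h.symm
  have hdim := ringKrullDim_quotient_pow (k := k) hU hmax (Nat.one_le_iff_ne_zero.1 hs)
  rw [hUd] at hmax hdim
  have hcount := card_truncatedStandard_card_topSet_eq hs hmax
  rw [Fintype.card_fin, ← Set.ncard_coe_finset {U | IsFace A U ∧ #U = d},
    coe_filter] at hcount
  simp only [mem_univ, true_and] at hcount
  rw [← numAssPrimes_eq (k := k) hmax] at hcount
  rw [← hcount, e₀, hdim]
  rcases d with _ | d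
  · rw [if_pos (by simp), finrank_quotient_pow_of_forall_card_le_zero hmax,
      filter_true_of_mem]
    intro t ht
    exact Nat.le_zero.1 (hmax _ (isFace_topSet (mem_truncatedStandard.1 ht).2))
  · -- The multiplicity uses the coefficient in degree `dim - 1`, which is `d` here.
    have hpoly : IsHilbertPolynomial (I ^ s) (standardPolynomial A s) := by
      filter_upwards [Filter.eventually_gt_atTop (Fintype.card (Fin n) * s)] with a ha
      rw [eval_standardPolynomial ha, hilbertFunction_pow]
    have hD : (((d + 1 : ℕ) : WithBot ℕ∞).unbotD 0).toNat - 1 = d := by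
      have : ((d + 1 : ℕ) : WithBot ℕ∞) = (((d + 1 : ℕ) : ℕ∞) : WithBot ℕ∞) := rfl
      rw [this, WithBot.unbotD_coe, ENat.toNat_natCast, Nat.add_sub_cancel]
    rw [if_neg (by exact_mod_cast d.succ_ne_zero), hD, hpoly.eq,
      factorial_mul_coeff_standardPolynomial hmax]

end Multiplicity

end MonomialPowers

theorem theorem1p1 {k : Type*} [Field k] (n d : ℕ) (I : Ideal (MvPolynomial (Fin n) k))
    (hI : MonomialPowers.IsSquarefreeMonomialIdeal I) (hI0 : I ≠ ⊥)
    (hd : ringKrullDim (MvPolynomial (Fin n) k ⧸ I) = d) (s : ℕ) (hs : 1 ≤ s) :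
    MonomialPowers.e₀ (I ^ s) =
      ((MonomialPowers.numAssPrimes I d * (n - d + s - 1).choose (s - 1) : ℕ) : ℚ) := by
  obtain ⟨A, rfl⟩ := hI
  exact MonomialPowers.e₀_span_pow A hd hs
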